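/- Let $T$ be a finite tree with a set $F$ of *final* nodes, rooted at a node $r\in F$, such that a node $v\neq r$ lies in $F$ if and only if it is a leaf (has degree one). (The components $T_i$ of a Steiner tree, with root $r=r_i$, are of this form.) For a node $u\ne r$ let $Q_u$ be the vertex set of the subtree rooted at $u$. For a set $W$ of edges (pairs of nodes) and a node $v$, let $w(v)$ be the number of edges $pq\in W$ such that $v$ lies on the $p$–$q$ path of $T$ (endpoints included), plus $1$ if $v\in F$. Put $h_W(Q)=\sum_{v\in Q}H_{w(v)}$, where $H_n=\sum_{i=1}^n 1/i$. Let $\phi=1.86-\frac1{2100}$, $\delta=\frac{97}{420}$, and $\beta(k)=0$ for $k\le 8$, $\beta(k)=\frac13-\delta$ for $k\ge 9$. The *marking algorithm* computes, from the leaves towards the root, for every node $u\neq r$ a marked path $P(u)$ ending in a final node $\ell(u)$, and a witness tree with edge set $W^u$ containing the edge $e^u=\ell(u)r$. Write $w^u$ for the vector $w$ of $W^u$ and $$C_j^u=\sum_{v\in P(u)\setminus\{\ell(u)\}}\bigl(H_{w^u(v)+j}-H_{w^u(v)+j-1}\bigr)\qquad(j\ge1).$$ * If $u$ is final, then $P(u)=\{u\}$,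 $\ell(u)=u$ and $W^u=\{ur\}$ (so $C^u_j=0$). * If $u$ is not final and has children $u_1,\dots,u_k$, one child $u_m$ is marked as follows. If no child is final, $u_m$ is a child with least $C_1^{u_j}$. If some child is final and every non-final child has $C_1^{u_j}\ge\phi-\delta-H_2$ (in particular if all children are final), $u_m$ is a final child. Otherwise $u_m$ is a non-final child with least $C_1^{u_j}$ among the non-final children. Ties are broken arbitrarily. Then $P(u)=\{u\}\cup P(u_m)$, $\ell(u)=\ell(u_m)$, and $$W^u=\bigcup_{j=1}^k\bigl(W^{u_j}\setminus\{e^{u_j}\}\bigr)\cup\{\ell(u_m)\ell(u_j):j\ne m\}\cup\{\ell(u)r\}.$$ **Lemma.** For every node $u\neq r$ of $T$, with $k\geq 0$ children, the algorithm has an output at $u$, and every output it can have at $u$ satisfies $$h_{W^u}(Q_u)\le\phi\,|Q_u|-C_1^u-\delta-\beta(k).$$ -/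

import Mathlib

open Finset

/-- A finite tree with a set of final nodes, rooted at a final node, in which the final nodes other
than the root are exactly the leaves other than the root. -/
structure FinalTree (V : Type*) where
  graph : SimpleGraph V
  isTree : graph.IsTree
  final : Finset V
  root : V
  root_final : root ∈ final
  final_iff_leaf : ∀ v, v ≠ root → (v ∈ final ↔ (graph.neighborSet v).ncard = 1)

/-- What the marking algorithm records at a node `u`: the vertices of the marked path `P(u)`,
its final end `ℓ(u)`, and the edge set of the witness tree `W^u`. -/
structure MarkingOutput (V : Type*) where
  path : Finset V
  leaf : V
  edges : Finset (Sym2 V)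

/-- The constant `φ`. -/
def phiConst : ℚ := 186 / 100 - 1 / 2100

/-- The constant `δ`. -/
def deltaConst : ℚ := 97 / 420

/-- The function `β`. -/
def betaFun (k : ℕ) : ℚ := if k ≤ 8 then 0 else 1 / 3 - deltaConst

namespace FinalTree

/-- The vertex `v` lies on the path of the tree between `p` and `q` (endpoints included). -/
def OnPath {V : Type*} (T : FinalTree V) (p q v : V) : Prop :=
  ∃ P : T.graph.Walk p q, P.IsPath ∧ v ∈ P.support

open Classical in
/-- The vertex set `Q_u` of the subtree rooted at `u`. -/
noncomputable def subtree {V : Type*} [Fintype V] (T : FinalTree V) (u : V) : Finset V :=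
  {v | T.OnPath T.root v u}

open Classical in
/-- The children of `u`. -/
noncomputable def children {V : Type*} [Fintype V] (T : FinalTree V) (u : V) : Finset V :=
  {c | T.graph.Adj u c ∧ c ∈ T.subtree u}

open Classical in
/-- The number `w(v)` that the witness edges `W` impose on `v`: the number of edges of `W` whose
path in the tree contains `v`, plus one if `v` is final. -/
noncomputable def load {V : Type*} (T : FinalTree V) (W : Finset (Sym2 V)) (v : V) : ℕ :=
  #{e ∈ W | ∃ p q, e = s(p, q) ∧ T.OnPath p q v} + if v ∈ T.final then 1 else 0

/-- `h_W(Q)`, the sum of the harmonic numbers `H_{w(v)}` over `v ∈ Q`. -/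
noncomputable def harmonicSum {V : Type*} (T : FinalTree V) (W : Finset (Sym2 V))
    (Q : Finset V) : ℚ :=
  ∑ v ∈ Q, harmonic (T.load W v)

/-- `C_j^u`, the sum of `H_{w(v)+j} - H_{w(v)+j-1}` over `v ∈ P(u) \ ℓ(u)` (for `j ≥ 1`). -/
noncomputable def increase {V : Type*} [DecidableEq V] (T : FinalTree V) (A : MarkingOutput V)
    (j : ℕ) : ℚ :=
  ∑ v ∈ A.path.erase A.leaf,
    (harmonic (T.load A.edges v + j) - harmonic (T.load A.edges v + j - 1))

/-- The marking rule: `m` may be marked as the child of `u`, given the outputs `A c` at the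
children `c` of `u`. Without final children, a child of least `C_1` is marked; if there is a final
child and every non-final child has `C_1 ≥ φ - δ - H_2`, a final child is marked; otherwise a
non-final child of least `C_1` among the non-final children is marked. -/
def MayMark {V : Type*} [Fintype V] [DecidableEq V] (T : FinalTree V) (u : V)
    (A : V → MarkingOutput V) (m : V) : Prop :=
  m ∈ T.children u ∧
    (((∀ c ∈ T.children u, c ∉ T.final) ∧
        ∀ c ∈ T.children u, T.increase (A m) 1 ≤ T.increase (A c) 1) ∨
      (m ∈ T.final ∧
        ∀ c ∈ T.children u, c ∉ T.final →
          phiConst - deltaConst - harmonic 2 ≤ T.increase (A c) 1) ∨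
      ((∃ c ∈ T.children u, c ∈ T.final) ∧
        (∃ c ∈ T.children u, c ∉ T.final ∧
          T.increase (A c) 1 < phiConst - deltaConst - harmonic 2) ∧
        m ∉ T.final ∧
        ∀ c ∈ T.children u, c ∉ T.final → T.increase (A m) 1 ≤ T.increase (A c) 1))

/-- The step of the algorithm at a non-final node `u` whose marked child is `m`: remove from each
`W^c` its edge `e^c` from `ℓ(c)` to the root, take the union over the children `c`, and add the
edges `ℓ(m)ℓ(c)` for `c ≠ m` and the edge `e^u` from `ℓ(u) = ℓ(m)` to the root. -/
noncomputable def join {V : Type*} [Fintype V] [DecidableEq V] (T : FinalTree V) (u : V)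
    (A : V → MarkingOutput V) (m : V) : MarkingOutput V where
  path := insert u (A m).path
  leaf := (A m).leaf
  edges :=
    ((T.children u).biUnion fun c => (A c).edges.erase s((A c).leaf, T.root)) ∪
      ((T.children u).erase m).image (fun c => s((A m).leaf, (A c).leaf)) ∪
      {s((A m).leaf, T.root)}

/-- `T.Builds u A`: some run of the marking algorithm (with any choice among the children that may
be marked) has output `A` at the non-root node `u`. -/
inductive Builds {V : Type*} [Fintype V] [DecidableEq V] (T : FinalTree V) :
    V → MarkingOutput V → Prop
  | final (u : V) (hne : u ≠ T.root) (hu : u ∈ T.final) :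
      Builds T u ⟨{u}, u, {s(u, T.root)}⟩
  | node (u : V) (A : V → MarkingOutput V) (m : V) (hu : u ∉ T.final)
      (hA : ∀ c ∈ T.children u, Builds T c (A c)) (hm : T.MayMark u A m) :
      Builds T u (T.join u A m)

end FinalTree

/-! The proof is an induction from the leaves to the root. Let $u$ have $k$ children and marked
child $m$. Passing from the $W^c$ to $W^u$ changes loads in few places: $u$ gets load $k$, the loads
on $P(m)$ rise by $k-1$, and all other loads in the children's subtrees stay the same, since each
$e^c$ is replaced by an edge with the same trace on $Q_c$. Hence $h_{W^u}(Q_u)+C_1^u$ equals the sum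
of the children's $h$, plus $H_{k+1}$, plus an increment of $k$ steps at each non-leaf vertex of
$P(m)$ and of $k-1$ steps at its leaf (`harmonicSum_join_add_increase`).

The marking rule makes every child gain a common amount $g$, that is, $h(Q_c)\le\phi|Q_c|-\delta-g$,
and the $kg$ so obtained must pay for the marked path (`join_bound`). If $m$ is final,
$g=\phi-\delta-H_2=9/70$ and only the leaf has to be paid for. If not, $g=C_1^m$; by concavity of
$H$ each non-leaf vertex of $P(m)$ costs at most its share of $kC_1^m$, so it suffices to keep the
term of $m$ itself, whose load is its number $a$ of children, and that of the leaf, whose load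
exceeds $a$.

This leaves two inequalities on harmonic numbers, `two_harmonic_add_betaFun_le` and
`harmonic_marked_path_le`. The first is an equality at $k=4$, the second at $k=4$, $a\in\{3,4\}$;
these two equations determine $\phi$ and $\delta$. -/

/-! ### Inequalities for harmonic numbers. -/

theorem harmonic_add_sub_antitone {a b : ℕ} (h : a ≤ b) (k : ℕ) :
    harmonic (b + k) - harmonic b ≤ harmonic (a + k) - harmonic a := by
  induction k with
  | zero => simp
  | succ k ih =>
    rw [← add_assoc, ← add_assoc, harmonic_succ, harmonic_succ]
    have : (((b + k + 1 : ℕ) : ℚ))⁻¹ ≤ ((a + k + 1 : ℕ) : ℚ)⁻¹ := by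
      apply inv_anti₀ (by positivity)
      exact_mod_cast (by omega : a + k + 1 ≤ b + k + 1)
    linarith

/-- Concavity: each of the $k$ steps is at most the first one. This lets $k\,C_1$ pay for raising
the loads on the marked path by $k$. -/
theorem harmonic_add_sub_le (a k : ℕ) :
    harmonic (a + k) - harmonic a ≤ k * (harmonic (a + 1) - harmonic a) := by
  induction k with
  | zero => simp
  | succ k ih =>
    have := harmonic_add_sub_antitone (show a ≤ a + k by omega) 1
    rw [add_assoc] at this
    push_cast
    linarith

theorem betaFun_nonneg (k : ℕ) : 0 ≤ betaFun k := by
  unfold betaFun deltaConst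
  split_ifs <;> norm_num

theorem betaFun_le (k : ℕ) : betaFun k ≤ 43 / 420 := by
  unfold betaFun deltaConst
  split_ifs <;> norm_num

/-- The case of a marked final child. One $H_{k+1}$ comes from the new vertex together with its term
in $C_1$; the other, less $H_2=3/2$, comes from the leaf, whose load rises from $2$ to $k+1$. -/
theorem two_harmonic_add_betaFun_le (k : ℕ) (hk : 1 ≤ k) :
    2 * harmonic (k + 1) - 3 / 2 + betaFun k ≤
      phiConst + (k - 1) * deltaConst + k * (9 / 70) := by
  by_cases h : k ≤ 8
  · interval_cases k <;> norm_num [harmonic_succ, betaFun, phiConst, deltaConst]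
  -- Here $43/420$ is the value of $\beta$ for $k\ge 9$. Each step adds at most $2/11$ on the left
  -- and $\delta+9/70>2/11$ on the right.
  · have key : 2 * harmonic (k + 1) - 3 / 2 + 43 / 420 ≤
        phiConst + (k - 1) * deltaConst + k * (9 / 70) := by
      induction k, (by omega : 9 ≤ k) using Nat.le_induction with
      | base => norm_num [harmonic_succ, phiConst, deltaConst]
      | succ n hn ih =>
        have ih' := ih (by omega) (by omega)
        rw [harmonic_succ]
        have : (((n + 1 + 1 : ℕ) : ℚ))⁻¹ ≤ (11 : ℚ)⁻¹ := by
          apply inv_anti₀ (by positivity)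
          exact_mod_cast (by omega : 11 ≤ n + 1 + 1)
        push_cast at this ⊢
        unfold deltaConst at *
        linarith
    linarith [betaFun_le k]

/-- A bound uniform in $a$ for the two increments in `harmonic_marked_path_le`, summed termwise.
With $b=a+1$, $d=k+1$ and $x=d/b$, the new term times $d$ is $x(1-x)/(1+x)$, whose maximum
$3-2\sqrt2$ lies just below $7/40$. -/
theorem harmonic_double_sub_le (a k : ℕ) :
    (harmonic (a + (k + 1)) - harmonic a - (k + 1) * (harmonic (a + 1) - harmonic a)) +
      (harmonic (a + (k + 1)) - harmonic (a + 1)) ≤ 7 / 40 * harmonic k := by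
  induction k with
  | zero => simp
  | succ k ih =>
    have e : harmonic (a + (k + 1 + 1)) = harmonic (a + (k + 1)) + (a + k + 2 : ℚ)⁻¹ := by
      rw [show a + (k + 1 + 1) = a + (k + 1) + 1 by ring, harmonic_succ]
      push_cast; ring_nf
    have e' : harmonic (a + 1) = harmonic a + (a + 1 : ℚ)⁻¹ := by
      rw [harmonic_succ]; push_cast; rfl
    have t : 2 * (a + k + 2 : ℚ)⁻¹ - (a + 1 : ℚ)⁻¹ ≤ 7 / 40 * (k + 1 : ℚ)⁻¹ := by
      have hb : (0 : ℚ) < a + 1 := by positivity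
      have hd : (0 : ℚ) < k + 1 := by positivity
      have hs : (a + k + 2 : ℚ) = (a + 1) + (k + 1) := by ring
      rw [hs]
      generalize (a + 1 : ℚ) = b at *
      generalize (k + 1 : ℚ) = d at *
      rw [← sub_nonneg]
      have : 7 / 40 * d⁻¹ - (2 * (b + d)⁻¹ - b⁻¹) =
          (7 * b ^ 2 - 33 * b * d + 40 * d ^ 2) / (40 * d * b * (b + d)) := by
        have : b + d ≠ 0 := by positivity
        field_simp
        ring
      rw [this]
      apply div_nonneg _ (by positivity)
      -- Indeed $28(7b^2-33bd+40d^2)=(14b-33d)^2+31d^2$.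
      nlinarith [sq_nonneg (14 * b - 33 * d), sq_nonneg d]
    rw [e, harmonic_succ k, e']
    rw [e'] at ih
    push_cast
    linarith

/-- The case of a marked non-final child with $a$ children. The first bracket is the excess cost of
its top vertex over its share of $k\,C_1$, the second the cost of the leaf. The uniform bound is too
weak for $k\le5$, where small $a$ is checked directly. -/
theorem harmonic_marked_path_le (a k : ℕ) (ha : 1 ≤ a) (hk : 1 ≤ k) :
    harmonic (k + 1) + (harmonic (a + k) - harmonic a - k * (harmonic (a + 1) - harmonic a)) +
      (harmonic (a + k) - harmonic (a + 1)) + betaFun k ≤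
        phiConst + (k - 1) * deltaConst := by
  obtain ⟨n, rfl⟩ : ∃ n, k = n + 1 := ⟨k - 1, by omega⟩
  have key := harmonic_double_sub_le a n
  push_cast
  by_cases h : n ≤ 4
  · have e' : harmonic (a + 1) = harmonic a + (a + 1 : ℚ)⁻¹ := by
      rw [harmonic_succ]; push_cast; rfl
    by_cases h' : a ≤ 10
    · interval_cases n <;> interval_cases a <;>
        norm_num [harmonic_succ, betaFun, phiConst, deltaConst]
    -- For $a\ge 11$ the first bracket is at most $0$ and the second at most $n/12$. This just
    -- suffices: at $n=4$ it gives equality.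
    · have h1 := harmonic_add_sub_le a (n + 1)
      have h2 := harmonic_add_sub_antitone (show a ≤ a + 1 by omega) n
      have h3 := harmonic_add_sub_le (a + 1) n
      have h4 := harmonic_add_sub_antitone (show a ≤ a + 1 by omega) 1
      have h5 : (a + 1 : ℚ)⁻¹ ≤ (12 : ℚ)⁻¹ := by
        apply inv_anti₀ (by positivity)
        exact_mod_cast (by omega : 12 ≤ a + 1)
      have h6 : harmonic (a + (n + 1)) - harmonic (a + 1) ≤ n * (12 : ℚ)⁻¹ := by
        rw [show a + (n + 1) = a + 1 + n by ring]
        refine h3.trans (mul_le_mul_of_nonneg_left ?_ (by positivity))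
        linarith
      push_cast at h1
      interval_cases n <;> norm_num [harmonic_succ 0, harmonic_succ 1, harmonic_succ 2,
        harmonic_succ 3, harmonic_succ 4, harmonic_succ 5,
        betaFun, phiConst, deltaConst] at h1 h6 ⊢ <;> linarith
  · by_cases h' : n ≤ 6
    · have : harmonic (n + 1 + 1) + 7 / 40 * harmonic n + betaFun (n + 1) ≤
          phiConst + n * deltaConst := by
        have : 5 ≤ n := by omega
        interval_cases n <;> norm_num [harmonic_succ, betaFun, phiConst, deltaConst]
      linarith
    · have : harmonic (n + 1 + 1) + 7 / 40 * harmonic n + 43 / 420 ≤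
          phiConst + n * deltaConst := by
        clear key hk h
        induction n, (by omega : 7 ≤ n) using Nat.le_induction with
        | base => norm_num [harmonic_succ, phiConst, deltaConst]
        | succ n hn ih =>
          have ih' := ih (by omega)
          rw [harmonic_succ, harmonic_succ n]
          have h1 : (((n + 1 + 1 + 1 : ℕ) : ℚ))⁻¹ ≤ (10 : ℚ)⁻¹ := by
            apply inv_anti₀ (by positivity)
            exact_mod_cast (by omega : 10 ≤ n + 1 + 1 + 1)
          have h2 : (((n + 1 : ℕ) : ℚ))⁻¹ ≤ (8 : ℚ)⁻¹ := by
            apply inv_anti₀ (by positivity)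
            exact_mod_cast (by omega : 8 ≤ n + 1)
          rw [Nat.cast_succ n] at h2 ⊢
          unfold deltaConst at *
          linarith
      linarith [betaFun_le (n + 1)]

/-! ### Paths and rooted subtrees. -/

namespace FinalTree

variable {V : Type*} (T : FinalTree V)

/-- By uniqueness of paths, lying on the path means being unavoidable by walks. Walks can be
concatenated freely, which makes the detour arguments below short. -/
theorem onPath_iff {p q v : V} : T.OnPath p q v ↔ ∀ W : T.graph.Walk p q, v ∈ W.support := by
  classical
  constructor
  · rintro ⟨P, hP, hv⟩ W
    have := (T.isTree.isAcyclic.subsingleton_path p q).elim ⟨P, hP⟩ ⟨W.bypass, W.bypass_isPath⟩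
    have h' : P = W.bypass := congrArg Subtype.val this
    exact W.support_bypass_subset_support (h' ▸ hv)
  · intro h
    obtain ⟨W⟩ := T.isTree.connected.preconnected p q
    exact ⟨W.bypass, W.bypass_isPath, h _⟩

variable {T}

theorem not_onPath_iff {p q v : V} :
    ¬ T.OnPath p q v ↔ ∃ W : T.graph.Walk p q, v ∉ W.support := by
  rw [onPath_iff]; push Not; rfl

theorem OnPath.symm {p q v : V} (h : T.OnPath p q v) : T.OnPath q p v := by
  rw [onPath_iff] at *
  intro W
  simpa using h W.reverse

theorem onPath_left (p q : V) : T.OnPath p q p := by simp [onPath_iff]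

theorem onPath_right (p q : V) : T.OnPath p q q := by simp [onPath_iff]

theorem onPath_self {p v : V} : T.OnPath p p v ↔ v = p :=
  ⟨fun h => by simpa using (onPath_iff T).1 h .nil, fun h => h ▸ onPath_left _ _⟩

/-- A path avoids every vertex avoided by two paths of a detour. -/
theorem OnPath.or {p q v : V} (h : T.OnPath p q v) (x : V) : T.OnPath p x v ∨ T.OnPath x q v := by
  by_contra hc
  push Not at hc
  obtain ⟨W, hW⟩ := not_onPath_iff.1 hc.1
  obtain ⟨W', hW'⟩ := not_onPath_iff.1 hc.2
  have := (onPath_iff T).1 h (W.append W')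
  rw [SimpleGraph.Walk.mem_support_append_iff] at this
  tauto

theorem OnPath.trans {p q x v : V} (hx : T.OnPath p q x) (hv : T.OnPath p x v) :
    T.OnPath p q v := by
  classical
  rw [onPath_iff] at *
  intro W
  exact W.support_takeUntil_subset_support (hx W) (hv _)

theorem OnPath.antisymm {p x y : V} (h : T.OnPath p x y) (h' : T.OnPath p y x) : x = y := by
  classical
  obtain ⟨P, hP, hy⟩ := h
  by_contra hne
  exact SimpleGraph.Walk.endpoint_notMem_support_takeUntil hP hy hne
    ((onPath_iff T).1 h' _)

/-- If `x` comes before `v` on a path ending in `q`, then `v` comes after `x`. -/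
theorem OnPath.tail {p q x v : V} (hx : T.OnPath p q x) (hv : T.OnPath x q v) :
    T.OnPath p v x := by
  classical
  obtain ⟨P, hP, hxP⟩ := hx
  have hvP : v ∈ (P.dropUntil x hxP).support := (onPath_iff T).1 hv _
  refine ⟨(P.takeUntil x hxP).append ((P.dropUntil x hxP).takeUntil v hvP), ?_, by simp⟩
  have h : (P.takeUntil x hxP).append (((P.dropUntil x hxP).takeUntil v hvP).append
      ((P.dropUntil x hxP).dropUntil v hvP)) = P := by
    rw [SimpleGraph.Walk.take_spec, SimpleGraph.Walk.take_spec]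
  rw [SimpleGraph.Walk.append_assoc] at h
  rw [← h] at hP
  exact hP.of_append_left

theorem onPath_adj_iff {p q v : V} (h : T.graph.Adj p q) : T.OnPath p q v ↔ v = p ∨ v = q := by
  refine ⟨fun hv => by simpa using (onPath_iff T).1 hv (.cons h .nil), ?_⟩
  rintro (rfl | rfl)
  exacts [onPath_left _ _, onPath_right _ _]

theorem onPath_of_adj_adj {x u y : V} (h : T.graph.Adj x u) (h' : T.graph.Adj u y) (hne : x ≠ y) :
    T.OnPath x y u :=
  ⟨.cons h (.cons h' .nil), by simp [SimpleGraph.Walk.isPath_def, h.ne, h'.ne, hne], by simp⟩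

theorem exists_adj_onPath {p q : V} (hne : p ≠ q) : ∃ x, T.graph.Adj p x ∧ T.OnPath p q x := by
  obtain ⟨W⟩ := T.isTree.connected.preconnected p q
  classical
  have hP := W.bypass_isPath
  generalize W.bypass = P at hP
  cases P with
  | nil => exact absurd rfl hne
  | cons h P => exact ⟨_, h, _, hP, by simp⟩

variable [Fintype V]

theorem mem_subtree {u v : V} : v ∈ T.subtree u ↔ T.OnPath T.root v u := by
  simp [subtree]

theorem mem_children {u c : V} : c ∈ T.children u ↔ T.graph.Adj u c ∧ c ∈ T.subtree u := by
  simp [children]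

theorem self_mem_subtree (u : V) : u ∈ T.subtree u := mem_subtree.2 (onPath_right _ _)

theorem root_notMem_subtree {u : V} (hu : u ≠ T.root) : T.root ∉ T.subtree u := by
  rw [mem_subtree, onPath_self]; exact hu

theorem subtree_antisymm {u v : V} (h : v ∈ T.subtree u) (h' : u ∈ T.subtree v) : u = v :=
  OnPath.antisymm (mem_subtree.1 h') (mem_subtree.1 h)

theorem subtree_subset {u v : V} (h : v ∈ T.subtree u) : T.subtree v ⊆ T.subtree u := by
  intro x hx
  rw [mem_subtree] at *
  exact hx.trans h

theorem mem_subtree_of_onPath_root {u p v : V} (hp : p ∈ T.subtree u) (hv : T.OnPath u p v) :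
    v ∈ T.subtree u :=
  mem_subtree.2 ((mem_subtree.1 hp).tail hv)

theorem subtree_convex {u p q v : V} (hp : p ∈ T.subtree u) (hq : q ∈ T.subtree u)
    (hv : T.OnPath p q v) : v ∈ T.subtree u := by
  rcases hv.or u with h | h
  · exact mem_subtree_of_onPath_root hp h.symm
  · exact mem_subtree_of_onPath_root hq h

theorem notMem_subtree_of_onPath {u p q v : V} (hp : p ∉ T.subtree u) (hq : q ∉ T.subtree u)
    (hv : T.OnPath p q v) : v ∉ T.subtree u := by
  intro hvu
  rw [mem_subtree] at *
  rcases hv.or T.root with h | h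
  · exact hp (h.symm.trans hvu)
  · exact hq (h.trans hvu)

theorem onPath_top {u p q : V} (hp : p ∈ T.subtree u) (hq : q ∉ T.subtree u) :
    T.OnPath p q u := by
  rw [mem_subtree] at *
  exact (hp.symm.or q).resolve_right fun h => hq h.symm

/-- A path leaving $Q_u$ does so through $u$, so its trace on $Q_u$ does not depend on the outer
endpoint. This is why exchanging $e^c$ for another edge from $\ell(c)$ leaves the loads in $Q_c$
unchanged. -/
theorem onPath_iff_of_mem_subtree {u p q v : V} (hp : p ∈ T.subtree u) (hq : q ∉ T.subtree u)
    (hv : v ∈ T.subtree u) : T.OnPath p q v ↔ T.OnPath p u v := by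
  refine ⟨fun h => ?_, (onPath_top hp hq).trans⟩
  rcases h.or u with h | h
  · exact h
  · rcases h.or T.root with h' | h'
    · rw [subtree_antisymm hv (mem_subtree.2 h'.symm)]
      exact onPath_right _ _
    · exact absurd (mem_subtree.2 (h'.trans (mem_subtree.1 hv))) hq

theorem notMem_subtree_of_mem_children {u c : V} (hc : c ∈ T.children u) : u ∉ T.subtree c := by
  rw [mem_children] at hc
  exact fun h => hc.1.ne (subtree_antisymm hc.2 h)

theorem ne_root_of_mem_children {u c : V} (hc : c ∈ T.children u) : c ≠ T.root := by
  rintro rfl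
  exact notMem_subtree_of_mem_children hc (mem_subtree.2 (onPath_left _ _))

theorem sibling_notMem_subtree {u c d : V} (hc : c ∈ T.children u) (hd : d ∈ T.children u)
    (hne : c ≠ d) : d ∉ T.subtree c := by
  intro h
  rw [mem_subtree] at h
  rcases h.or u with h | h
  · exact notMem_subtree_of_mem_children hc (mem_subtree.2 h)
  · rcases (onPath_adj_iff (mem_children.1 hd).1).1 h with h | h
    · exact (mem_children.1 hc).1.ne h.symm
    · exact hne h

theorem disjoint_subtree {u c d : V} (hc : c ∈ T.children u) (hd : d ∈ T.children u)
    (hne : c ≠ d) : Disjoint (T.subtree c) (T.subtree d) := by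
  rw [Finset.disjoint_left]
  intro v hv hv'
  -- The path from a common vertex $v$ to $d$ leaves $Q_c$ through $c$, yet stays in $Q_d$; so $c$
  -- would lie in $Q_d$.
  have h := (onPath_iff_of_mem_subtree hv (sibling_notMem_subtree hc hd hne)
    (self_mem_subtree c)).2 (onPath_right _ _)
  exact sibling_notMem_subtree hd hc hne.symm
    (mem_subtree_of_onPath_root hv' h.symm)

theorem exists_child {u v : V} (hv : v ∈ T.subtree u) (hne : v ≠ u) :
    ∃ c ∈ T.children u, v ∈ T.subtree c := by
  obtain ⟨c, hadj, hc⟩ := exists_adj_onPath (T := T) hne.symm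
  have hcu := mem_subtree_of_onPath_root hv hc
  refine ⟨c, mem_children.2 ⟨hadj, hcu⟩, ?_⟩
  have huc : u ∉ T.subtree c := notMem_subtree_of_mem_children (mem_children.2 ⟨hadj, hcu⟩)
  rw [mem_subtree] at *
  exact ((hc.symm).or T.root).elim .symm fun h => absurd h huc

theorem subtree_eq [DecidableEq V] (u : V) :
    T.subtree u = insert u ((T.children u).biUnion T.subtree) := by
  ext v
  rw [mem_insert, mem_biUnion]
  constructor
  · intro hv
    by_cases h : v = u
    · exact .inl h
    · exact .inr (exists_child hv h)
  · rintro (rfl | ⟨c, hc, hv⟩)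
    · exact self_mem_subtree _
    · exact subtree_subset (mem_children.1 hc).2 hv

theorem sum_subtree {M : Type*} [AddCommMonoid M] (u : V) (f : V → M) :
    ∑ v ∈ T.subtree u, f v = f u + ∑ c ∈ T.children u, ∑ v ∈ T.subtree c, f v := by
  classical
  rw [subtree_eq, sum_insert, sum_biUnion]
  · exact fun c hc d hd hne => disjoint_subtree hc hd hne
  · rw [mem_biUnion]
    rintro ⟨c, hc, h⟩
    exact notMem_subtree_of_mem_children hc h

theorem children_eq_empty {u : V} (hne : u ≠ T.root) (hu : u ∈ T.final) : T.children u = ∅ := by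
  rw [eq_empty_iff_forall_notMem]
  intro c hc
  obtain ⟨x, hx⟩ := Set.ncard_eq_one.1 ((T.final_iff_leaf u hne).1 hu)
  obtain ⟨y, hy, hy'⟩ := exists_adj_onPath (T := T) hne
  have h : ∀ z, T.graph.Adj u z → z = x := fun z hz => by
    have : z ∈ T.graph.neighborSet u := hz
    rwa [hx] at this
  rw [h y hy, ← h c (mem_children.1 hc).1] at hy'
  exact notMem_subtree_of_mem_children hc (mem_subtree.2 hy'.symm)

theorem children_nonempty {u : V} (hu : u ∉ T.final) : (T.children u).Nonempty := by
  have hne : u ≠ T.root := fun h => hu (h ▸ T.root_final)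
  by_contra hc
  rw [not_nonempty_iff_eq_empty, eq_empty_iff_forall_notMem] at hc
  apply hu
  rw [T.final_iff_leaf u hne, Set.ncard_eq_one]
  obtain ⟨x, hx, -⟩ := exists_adj_onPath (T := T) hne
  refine ⟨x, Set.eq_singleton_iff_unique_mem.2 ⟨hx, fun y hy => ?_⟩⟩
  by_contra hxy
  have h : ∀ z, T.graph.Adj u z → z ∉ T.subtree u := fun z hz hzu =>
    hc z (mem_children.2 ⟨hz, hzu⟩)
  exact notMem_subtree_of_onPath (h x hx) (h y hy)
    (onPath_of_adj_adj hx.symm hy (Ne.symm hxy)) (self_mem_subtree u)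

theorem onPath_siblings {u c d p q : V} (hc : c ∈ T.children u) (hd : d ∈ T.children u)
    (hne : c ≠ d) (hp : p ∈ T.subtree c) (hq : q ∈ T.subtree d) : T.OnPath p q u := by
  have hqc : q ∉ T.subtree c := fun h =>
    Finset.disjoint_left.1 (disjoint_subtree hc hd hne) h hq
  have h1 := onPath_of_adj_adj (mem_children.1 hc).1.symm (mem_children.1 hd).1 hne
  have h2 : T.OnPath c q d :=
    (onPath_top hq (sibling_notMem_subtree hd hc hne.symm)).symm
  exact ((onPath_top hp hqc).symm.trans (h2.trans h1).symm).symm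

end FinalTree

/-! ### Edges of the witness tree crossing a vertex. -/

namespace FinalTree

variable {V : Type*} (T : FinalTree V)

open Classical in
/-- The number of edges of `W` whose path in the tree contains `v`. -/
noncomputable def crossing (W : Finset (Sym2 V)) (v : V) : ℕ :=
  #{e ∈ W | ∃ p q, e = s(p, q) ∧ T.OnPath p q v}

variable {T}

theorem load_eq_crossing (W : Finset (Sym2 V)) (v : V) [Decidable (v ∈ T.final)] :
    T.load W v = T.crossing W v + if v ∈ T.final then 1 else 0 := by
  unfold load crossing
  congr

theorem exists_eq_onPath_iff {p q v : V} :
    (∃ p' q', s(p, q) = s(p', q') ∧ T.OnPath p' q' v) ↔ T.OnPath p q v := by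
  constructor
  · rintro ⟨p', q', h, h'⟩
    rcases Sym2.eq_iff.1 h with ⟨rfl, rfl⟩ | ⟨rfl, rfl⟩
    exacts [h', h'.symm]
  · exact fun h => ⟨p, q, rfl, h⟩

open Classical in
theorem crossing_singleton (p q v : V) :
    T.crossing {s(p, q)} v = if T.OnPath p q v then 1 else 0 := by
  unfold crossing
  rw [filter_singleton]
  simp only [exists_eq_onPath_iff]
  split_ifs <;> simp

theorem crossing_union [DecidableEq V] {W W' : Finset (Sym2 V)} (h : Disjoint W W') (v : V) :
    T.crossing (W ∪ W') v = T.crossing W v + T.crossing W' v := by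
  classical
  unfold crossing
  rw [filter_union, card_union_of_disjoint (disjoint_filter_filter h)]

theorem crossing_biUnion [DecidableEq V] {ι : Type*} {S : Finset ι}
    {W : ι → Finset (Sym2 V)} (h : (S : Set ι).PairwiseDisjoint W) (v : V) :
    T.crossing (S.biUnion W) v = ∑ i ∈ S, T.crossing (W i) v := by
  classical
  unfold crossing
  rw [filter_biUnion, card_biUnion]
  exact fun i hi j hj hij => disjoint_filter_filter (h hi hj hij)

theorem crossing_image [DecidableEq V] {ι : Type*} {S : Finset ι} {p : V} {q : ι → V} {v : V}
    [∀ p q, Decidable (T.OnPath p q v)] (h : Set.InjOn (fun i => s(p, q i)) S) :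
    T.crossing (S.image fun i => s(p, q i)) v = #{i ∈ S | T.OnPath p (q i) v} := by
  classical
  unfold crossing
  rw [filter_image, card_image_of_injOn (h.mono (coe_subset.2 (filter_subset _ _)))]
  simp only [exists_eq_onPath_iff]

theorem crossing_eq_zero {W : Finset (Sym2 V)} {v : V}
    (h : ∀ p q, s(p, q) ∈ W → ¬ T.OnPath p q v) : T.crossing W v = 0 := by
  classical
  unfold crossing
  rw [card_eq_zero, filter_eq_empty_iff]
  rintro e he ⟨p, q, rfl, hv⟩
  exact h p q he hv

variable [Fintype V] [DecidableEq V]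

/-- The marked path of `A` is the tree path from its leaf up to `u`, and all edges of `A` but the
root edge stay inside the subtree of `u`. -/
structure IsOutput (T : FinalTree V) (u : V) (A : MarkingOutput V) : Prop where
  leaf_mem : A.leaf ∈ T.subtree u
  leaf_final : A.leaf ∈ T.final
  mem_path : ∀ v, v ∈ A.path ↔ T.OnPath A.leaf u v
  root_edge : s(A.leaf, T.root) ∈ A.edges
  inner : ∀ e ∈ A.edges.erase s(A.leaf, T.root), ∀ x ∈ e, x ∈ T.subtree u

theorem isOutput_final (u : V) (hu : u ∈ T.final) :
    IsOutput T u ⟨{u}, u, {s(u, T.root)}⟩ where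
  leaf_mem := self_mem_subtree u
  leaf_final := hu
  mem_path v := by simp [onPath_self]
  root_edge := by simp
  inner e he := by simp at he

namespace IsOutput

variable {u : V} {A : MarkingOutput V} (h : IsOutput T u A)
include h

theorem leaf_mem_path : A.leaf ∈ A.path := (h.mem_path _).2 (onPath_left _ _)

theorem top_mem_path : u ∈ A.path := (h.mem_path _).2 (onPath_right _ _)

theorem path_subset : A.path ⊆ T.subtree u := fun v hv =>
  subtree_convex h.leaf_mem (self_mem_subtree u) ((h.mem_path v).1 hv)

theorem onPath_outside {q v : V} (hq : q ∉ T.subtree u) (hv : v ∈ T.subtree u) :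
    T.OnPath A.leaf q v ↔ v ∈ A.path := by
  rw [onPath_iff_of_mem_subtree h.leaf_mem hq hv, h.mem_path]

theorem crossing_erase_of_notMem {v : V} (hv : v ∉ T.subtree u) :
    T.crossing (A.edges.erase s(A.leaf, T.root)) v = 0 :=
  crossing_eq_zero fun p q he hpq =>
    hv (subtree_convex (h.inner _ he p (by simp)) (h.inner _ he q (by simp)) hpq)

theorem crossing_eq (hu : u ≠ T.root) {v : V} (hv : v ∈ T.subtree u) :
    T.crossing A.edges v =
      T.crossing (A.edges.erase s(A.leaf, T.root)) v + if v ∈ A.path then 1 else 0 := by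
  classical
  have he : A.edges = A.edges.erase s(A.leaf, T.root) ∪ {s(A.leaf, T.root)} := by
    rw [union_comm, ← insert_eq, insert_erase h.root_edge]
  conv_lhs => rw [he]
  rw [crossing_union, crossing_singleton]
  · simp only [h.onPath_outside (root_notMem_subtree hu) hv]
  · simp

end IsOutput

section join

variable {u m : V} {A : V → MarkingOutput V} (hA : ∀ c ∈ T.children u, IsOutput T c (A c))
  (hm : m ∈ T.children u)
include hA hm

/-- The three groups of edges in the join can be counted separately: they are disjoint, because
their endpoints lie in one child's subtree, in two different ones, or at the root. -/
theorem crossing_join {v : V} [∀ p q, Decidable (T.OnPath p q v)] :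
    T.crossing (T.join u A m).edges v =
      ∑ c ∈ T.children u, T.crossing ((A c).edges.erase s((A c).leaf, T.root)) v +
      #{c ∈ (T.children u).erase m | T.OnPath (A m).leaf (A c).leaf v} +
      if T.OnPath (A m).leaf T.root v then 1 else 0 := by
  classical
  have hroot : ∀ c ∈ T.children u, T.root ∉ T.subtree c := fun c hc =>
    root_notMem_subtree (ne_root_of_mem_children hc)
  have hleaf : ∀ c ∈ T.children u, ∀ d ∈ T.children u, (A c).leaf ∈ T.subtree d → c = d := by
    intro c hc d hd h
    by_contra hne
    exact Finset.disjoint_left.1 (disjoint_subtree hc hd hne) (hA c hc).leaf_mem h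
  unfold join
  simp only
  rw [crossing_union, crossing_union, crossing_biUnion, crossing_image, crossing_singleton]
  · congr
  · intro c hc d hd h
    simp only [coe_erase, Set.mem_sdiff, mem_coe, Set.mem_singleton_iff] at hc hd
    rcases Sym2.eq_iff.1 h with ⟨-, h⟩ | ⟨h, -⟩
    · exact hleaf c hc.1 d hd.1 (h ▸ (hA d hd.1).leaf_mem)
    · exact absurd (hleaf m hm d hd.1 (h ▸ (hA d hd.1).leaf_mem)).symm hd.2
  · intro c hc d hd hne
    rw [Function.onFun, Finset.disjoint_left]
    intro e he he'
    induction e with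
    | _ x y =>
      exact Finset.disjoint_left.1 (disjoint_subtree hc hd hne)
        ((hA c hc).inner _ he x (by simp)) ((hA d hd).inner _ he' x (by simp))
  · rw [Finset.disjoint_left]
    intro e he he'
    obtain ⟨c, hc, hec⟩ := mem_biUnion.1 he
    obtain ⟨d, hd, rfl⟩ := mem_image.1 he'
    have h1 := hleaf m hm c hc ((hA c hc).inner _ hec _ (by simp))
    have h2 := hleaf d (mem_of_mem_erase hd) c hc ((hA c hc).inner _ hec _ (by simp))
    exact ne_of_mem_erase hd (h2.trans h1.symm)
  · rw [Finset.disjoint_singleton_right, mem_union]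
    rintro (he | he)
    · obtain ⟨c, hc, hec⟩ := mem_biUnion.1 he
      exact hroot c hc ((hA c hc).inner _ hec _ (by simp))
    · obtain ⟨d, hd, h⟩ := mem_image.1 he
      rw [mem_erase] at hd
      rcases Sym2.eq_iff.1 h with ⟨-, h⟩ | ⟨h, -⟩
      · exact hroot d hd.2 (h ▸ (hA d hd.2).leaf_mem)
      · exact hroot m hm (h ▸ (hA m hm).leaf_mem)

theorem crossing_join_top (hu : u ≠ T.root) :
    T.crossing (T.join u A m).edges u = #(T.children u) := by
  classical
  rw [crossing_join hA hm, sum_eq_zero, filter_true_of_mem, if_pos, card_erase_of_mem hm]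
  · have := card_pos.2 ⟨m, hm⟩
    omega
  · exact onPath_top (subtree_subset (mem_children.1 hm).2 (hA m hm).leaf_mem)
      (root_notMem_subtree hu)
  · intro c hc
    rw [mem_erase] at hc
    exact onPath_siblings hm hc.2 hc.1.symm (hA m hm).leaf_mem (hA c hc.2).leaf_mem
  · exact fun c hc => (hA c hc).crossing_erase_of_notMem (notMem_subtree_of_mem_children hc)

/-- In $Q_c$ with $c\ne m$, the only outgoing edge $\ell(m)\ell(c)$ replaces $e^c$. In $Q_m$, the
edge $e^m$ is replaced by $k$ outgoing edges from $\ell(m)$, each with trace $P(m)$. -/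
theorem crossing_join_of_mem {c v : V} (hc : c ∈ T.children u)
    (hv : v ∈ T.subtree c) :
    T.crossing (T.join u A m).edges v =
      T.crossing (A c).edges v + if v ∈ (A m).path then #(T.children u) - 1 else 0 := by
  classical
  have hout : ∀ d ∈ T.children u, d ≠ c → (A d).leaf ∉ T.subtree c := fun d hd hne h =>
    Finset.disjoint_left.1 (disjoint_subtree hd hc hne) (hA d hd).leaf_mem h
  have hroot := root_notMem_subtree (ne_root_of_mem_children hc)
  have hpos := card_pos.2 ⟨m, hm⟩
  rw [crossing_join hA hm, sum_eq_single c, (hA c hc).crossing_eq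
    (ne_root_of_mem_children hc) hv]
  · by_cases hcm : c = m
    · subst hcm
      have h1 : ∀ d ∈ (T.children u).erase c,
          (T.OnPath (A c).leaf (A d).leaf v ↔ v ∈ (A c).path) := fun d hd => by
        rw [mem_erase] at hd
        exact (hA c hc).onPath_outside (hout d hd.2 hd.1) hv
      rw [filter_congr h1, filter_const, (hA c hc).onPath_outside hroot hv]
      split_ifs
      · rw [card_erase_of_mem hc]; omega
      · simp
    · have h1 : ∀ d ∈ (T.children u).erase m,
          (T.OnPath (A m).leaf (A d).leaf v ↔ d = c ∧ v ∈ (A c).path) := fun d hd => by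
        rw [mem_erase] at hd
        constructor
        · intro h
          by_cases hdc : d = c
          · subst hdc
            exact ⟨rfl, ((hA d hc).onPath_outside (hout m hm (Ne.symm hcm)) hv).1 h.symm⟩
          · exact absurd hv (notMem_subtree_of_onPath (hout m hm (Ne.symm hcm))
              (hout d hd.2 hdc) h)
        · rintro ⟨rfl, h⟩
          exact (((hA d hc).onPath_outside (hout m hm (Ne.symm hcm)) hv).2 h).symm
      have h2 : ¬ T.OnPath (A m).leaf T.root v := fun h =>
        notMem_subtree_of_onPath (hout m hm (Ne.symm hcm)) hroot h hv
      have h3 : v ∉ (A m).path := fun h =>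
        Finset.disjoint_left.1 (disjoint_subtree hc hm hcm) hv ((hA m hm).path_subset h)
      rw [filter_congr h1, if_neg h2, if_neg h3, add_zero, add_zero]
      by_cases hvc : v ∈ (A c).path
      · have : {d ∈ (T.children u).erase m | d = c ∧ v ∈ (A c).path} = {c} := by
          ext d; simp only [mem_filter, mem_erase, mem_singleton]
          constructor
          · exact fun h => h.2.1
          · rintro rfl; exact ⟨⟨hcm, hc⟩, rfl, hvc⟩
        rw [this, if_pos hvc, card_singleton]
      · simp [hvc]
  · exact fun d hd hne => (hA d hd).crossing_erase_of_notMem fun h =>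
      Finset.disjoint_left.1 (disjoint_subtree hd hc hne) h hv
  · exact fun h => absurd hc h

theorem isOutput_join : IsOutput T u (T.join u A m) where
  leaf_mem := subtree_subset (mem_children.1 hm).2 (hA m hm).leaf_mem
  leaf_final := (hA m hm).leaf_final
  mem_path v := by
    have hum := notMem_subtree_of_mem_children hm
    change v ∈ insert u (A m).path ↔ T.OnPath (A m).leaf u v
    rw [mem_insert]
    constructor
    · rintro (rfl | h)
      · exact onPath_right _ _
      · exact ((hA m hm).onPath_outside hum ((hA m hm).path_subset h)).2 h
    · intro h
      rcases h.or m with h' | h'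
      · exact .inr (((hA m hm).mem_path v).2 h')
      · rcases (onPath_adj_iff (mem_children.1 hm).1.symm).1 h' with rfl | rfl
        · exact .inr (hA v hm).top_mem_path
        · exact .inl rfl
  root_edge := by simp [join]
  inner e he x hx := by
    obtain ⟨hne, he⟩ := mem_erase.1 he
    have hsub : ∀ c ∈ T.children u, T.subtree c ⊆ T.subtree u := fun c hc =>
      subtree_subset (mem_children.1 hc).2
    simp only [join, mem_union, mem_singleton] at he hne
    rcases he with (he | he) | he
    · obtain ⟨c, hc, hec⟩ := mem_biUnion.1 he
      exact hsub c hc ((hA c hc).inner _ hec x hx)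
    · obtain ⟨d, hd, rfl⟩ := mem_image.1 he
      rw [mem_erase] at hd
      rcases Sym2.mem_iff.1 hx with rfl | rfl
      · exact hsub m hm (hA m hm).leaf_mem
      · exact hsub d hd.2 (hA d hd.2).leaf_mem
    · exact absurd he hne

end join

end FinalTree

/-! ### Loads, harmonic sums and the inductive step. -/

namespace FinalTree

variable {V : Type*} {T : FinalTree V}

theorem increase_one [DecidableEq V] (A : MarkingOutput V) :
    T.increase A 1 = ∑ v ∈ A.path.erase A.leaf,
      (harmonic (T.load A.edges v + 1) - harmonic (T.load A.edges v)) := rfl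

theorem load_final {u : V} (hu : u ∈ T.final) : T.load {s(u, T.root)} u = 2 := by
  classical
  rw [load_eq_crossing, crossing_singleton, if_pos (onPath_left _ _), if_pos hu]

theorem increase_final [DecidableEq V] (u : V) (j : ℕ) : T.increase ⟨{u}, u, {s(u, T.root)}⟩ j = 0 := by
  simp [increase]

variable [Fintype V] [DecidableEq V]

theorem IsOutput.two_le_load_leaf {u : V} {A : MarkingOutput V} (h : IsOutput T u A)
    (hu : u ≠ T.root) : 2 ≤ T.load A.edges A.leaf := by
  classical
  rw [load_eq_crossing, h.crossing_eq hu h.leaf_mem, if_pos h.leaf_mem_path,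
    if_pos h.leaf_final]
  omega

section join

variable {u m : V} {A : V → MarkingOutput V} (hA : ∀ c ∈ T.children u, IsOutput T c (A c))
  (hm : m ∈ T.children u)
include hA hm

theorem load_join_of_mem {c v : V} (hc : c ∈ T.children u) (hv : v ∈ T.subtree c) :
    T.load (T.join u A m).edges v =
      T.load (A c).edges v + if v ∈ (A m).path then #(T.children u) - 1 else 0 := by
  classical
  rw [load_eq_crossing, load_eq_crossing, crossing_join_of_mem hA hm hc hv]
  omega

variable (hu : u ∉ T.final)
include hu

theorem load_join_top : T.load (T.join u A m).edges u = #(T.children u) := by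
  classical
  rw [load_eq_crossing, crossing_join_top hA hm fun h => hu (h ▸ T.root_final), if_neg hu,
    add_zero]

theorem harmonicSum_join :
    T.harmonicSum (T.join u A m).edges (T.subtree u) =
      harmonic #(T.children u) + ∑ c ∈ T.children u, T.harmonicSum (A c).edges (T.subtree c) +
      ∑ v ∈ (A m).path, (harmonic (T.load (A m).edges v + (#(T.children u) - 1)) -
        harmonic (T.load (A m).edges v)) := by
  unfold harmonicSum
  rw [sum_subtree, load_join_top hA hm hu, add_assoc, ← add_sum_erase _ _ hm,
    ← add_sum_erase _ (fun c => ∑ v ∈ T.subtree c, harmonic (T.load (A c).edges v)) hm]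
  have h1 : ∑ v ∈ T.subtree m, harmonic (T.load (T.join u A m).edges v) =
      ∑ v ∈ T.subtree m, harmonic (T.load (A m).edges v) +
      ∑ v ∈ (A m).path, (harmonic (T.load (A m).edges v + (#(T.children u) - 1)) -
        harmonic (T.load (A m).edges v)) := by
    rw [← inter_eq_right.2 (hA m hm).path_subset, ← filter_mem_eq_inter, sum_filter,
      ← sum_add_distrib]
    refine sum_congr rfl fun v hv => ?_
    rw [load_join_of_mem hA hm hm hv]
    split_ifs <;> simp
  have h2 : ∀ c ∈ (T.children u).erase m,
      ∑ v ∈ T.subtree c, harmonic (T.load (T.join u A m).edges v) =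
        ∑ v ∈ T.subtree c, harmonic (T.load (A c).edges v) := by
    intro c hc
    rw [mem_erase] at hc
    refine sum_congr rfl fun v hv => ?_
    rw [load_join_of_mem hA hm hc.2 hv, if_neg, add_zero]
    exact fun h => Finset.disjoint_left.1 (disjoint_subtree hc.2 hm hc.1) hv
      ((hA m hm).path_subset h)
  rw [h1, sum_congr rfl h2]
  ring

theorem increase_join :
    T.increase (T.join u A m) 1 =
      harmonic (#(T.children u) + 1) - harmonic #(T.children u) +
      ∑ v ∈ (A m).path.erase (A m).leaf,
        (harmonic (T.load (A m).edges v + #(T.children u)) -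
          harmonic (T.load (A m).edges v + (#(T.children u) - 1))) := by
  have hum : u ∉ (A m).path := fun h =>
    notMem_subtree_of_mem_children hm ((hA m hm).path_subset h)
  have hpos := card_pos.2 ⟨m, hm⟩
  have hul : u ≠ (A m).leaf := fun h => hu (h.symm ▸ (hA m hm).leaf_final)
  rw [increase_one]
  change ∑ v ∈ (insert u (A m).path).erase (A m).leaf, _ = _
  rw [erase_insert_of_ne hul,
    sum_insert (fun h => hum (mem_of_mem_erase h)), load_join_top hA hm hu]
  congr 1
  refine sum_congr rfl fun v hv => ?_
  have hv' := mem_of_mem_erase hv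
  rw [load_join_of_mem hA hm hm ((hA m hm).path_subset hv'), if_pos hv', add_assoc,
    Nat.sub_add_cancel hpos]

/-- Adding $C_1^u$ telescopes: $H_k$ at $u$ becomes $H_{k+1}$, and $k-1$ steps become $k$ on the
marked path, except at the leaf, which $C_1$ omits. -/
theorem harmonicSum_join_add_increase :
    T.harmonicSum (T.join u A m).edges (T.subtree u) + T.increase (T.join u A m) 1 =
      harmonic (#(T.children u) + 1) +
      ∑ c ∈ T.children u, T.harmonicSum (A c).edges (T.subtree c) +
      ∑ v ∈ (A m).path.erase (A m).leaf,
        (harmonic (T.load (A m).edges v + #(T.children u)) -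
          harmonic (T.load (A m).edges v)) +
      (harmonic (T.load (A m).edges (A m).leaf + (#(T.children u) - 1)) -
        harmonic (T.load (A m).edges (A m).leaf)) := by
  rw [harmonicSum_join hA hm hu, increase_join hA hm hu,
    ← add_sum_erase _ _ (hA m hm).leaf_mem_path]
  simp only [sum_sub_distrib]
  ring

/-- If every child gains at least `g`, the cost of the marked path is paid for. -/
theorem join_bound {g : ℚ}
    (hg : ∀ c ∈ T.children u, T.harmonicSum (A c).edges (T.subtree c) ≤
      phiConst * #(T.subtree c) - deltaConst - g)
    (h : harmonic (#(T.children u) + 1) +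
      ∑ v ∈ (A m).path.erase (A m).leaf,
        (harmonic (T.load (A m).edges v + #(T.children u)) -
          harmonic (T.load (A m).edges v)) +
      (harmonic (T.load (A m).edges (A m).leaf + (#(T.children u) - 1)) -
        harmonic (T.load (A m).edges (A m).leaf)) + betaFun #(T.children u) ≤
      phiConst + (#(T.children u) - 1) * deltaConst + #(T.children u) * g) :
    T.harmonicSum (T.join u A m).edges (T.subtree u) ≤
      phiConst * #(T.subtree u) - T.increase (T.join u A m) 1 - deltaConst -
        betaFun #(T.children u) := by
  have h1 := harmonicSum_join_add_increase hA hm hu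
  have h2 := sum_le_sum hg
  have h3 : (#(T.subtree u) : ℚ) = 1 + ∑ c ∈ T.children u, (#(T.subtree c) : ℚ) := by
    have := sum_subtree (T := T) u fun _ => (1 : ℚ)
    simpa using this
  rw [sum_sub_distrib, sum_sub_distrib, ← mul_sum, sum_const, sum_const, nsmul_eq_mul,
    nsmul_eq_mul] at h2
  rw [h3]
  linarith

end join

/-- The invariant of the marking algorithm. -/
structure IsGood (T : FinalTree V) (u : V) (A : MarkingOutput V) : Prop where
  ne_root : u ≠ T.root
  isOutput : IsOutput T u A
  eq_of_final : u ∈ T.final → A = ⟨{u}, u, {s(u, T.root)}⟩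
  load_top : u ∉ T.final → T.load A.edges u = #(T.children u)
  lt_load_leaf : u ∉ T.final → #(T.children u) < T.load A.edges A.leaf
  bound : T.harmonicSum A.edges (T.subtree u) ≤
    phiConst * #(T.subtree u) - T.increase A 1 - deltaConst - betaFun #(T.children u)

theorem subtree_of_final {u : V} (hne : u ≠ T.root) (hu : u ∈ T.final) : T.subtree u = {u} := by
  rw [subtree_eq, children_eq_empty hne hu]; simp

theorem harmonicSum_final {u : V} (hne : u ≠ T.root) (hu : u ∈ T.final) :
    T.harmonicSum {s(u, T.root)} (T.subtree u) = 3 / 2 := by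
  rw [harmonicSum, subtree_of_final hne hu, sum_singleton, load_final hu]
  norm_num [harmonic_succ]

theorem isGood_final {u : V} (hne : u ≠ T.root) (hu : u ∈ T.final) :
    IsGood T u ⟨{u}, u, {s(u, T.root)}⟩ where
  ne_root := hne
  isOutput := isOutput_final u hu
  eq_of_final _ := rfl
  load_top h := absurd hu h
  lt_load_leaf h := absurd hu h
  bound := by
    rw [increase_final, children_eq_empty hne hu]
    simp only
    rw [harmonicSum_final hne hu, subtree_of_final hne hu]
    norm_num [betaFun, phiConst, deltaConst]

namespace IsGood

/-- The gain at a final child. -/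
theorem bound_final {c : V} {A : MarkingOutput V} (h : IsGood T c A) (hc : c ∈ T.final) :
    T.harmonicSum A.edges (T.subtree c) ≤ phiConst * #(T.subtree c) - deltaConst - 9 / 70 := by
  rw [h.eq_of_final hc]
  simp only
  rw [harmonicSum_final h.ne_root hc, subtree_of_final h.ne_root hc]
  norm_num [phiConst, deltaConst]

/-- The gain at a child with `C_1 ≥ g`. -/
theorem bound_of_le {c : V} {A : MarkingOutput V} (h : IsGood T c A) {g : ℚ}
    (hg : g ≤ T.increase A 1) :
    T.harmonicSum A.edges (T.subtree c) ≤ phiConst * #(T.subtree c) - deltaConst - g := by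
  linarith [h.bound, betaFun_nonneg #(T.children c)]

end IsGood

section join

variable {u m : V} {A : V → MarkingOutput V} (hA : ∀ c ∈ T.children u, IsGood T c (A c))
  (hm : m ∈ T.children u) (hu : u ∉ T.final)
include hA hm hu

theorem join_bound_final (hmf : m ∈ T.final)
    (h : ∀ c ∈ T.children u, c ∉ T.final → 9 / 70 ≤ T.increase (A c) 1) :
    T.harmonicSum (T.join u A m).edges (T.subtree u) ≤
      phiConst * #(T.subtree u) - T.increase (T.join u A m) 1 - deltaConst -
        betaFun #(T.children u) := by
  refine join_bound (fun c hc => (hA c hc).isOutput) hm hu (g := 9 / 70) (fun c hc => ?_) ?_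
  · by_cases hcf : c ∈ T.final
    · exact (hA c hc).bound_final hcf
    · exact (hA c hc).bound_of_le (h c hc hcf)
  · have hpos := card_pos.2 ⟨m, hm⟩
    have key := two_harmonic_add_betaFun_le _ hpos
    rw [(hA m hm).eq_of_final hmf]
    simp only [erase_singleton, sum_empty]
    rw [load_final hmf, show 2 + (#(T.children u) - 1) = #(T.children u) + 1 by omega,
      show harmonic 2 = 3 / 2 by norm_num [harmonic_succ]]
    linarith

theorem join_bound_of_notMem_final (hmf : m ∉ T.final)
    (h : ∀ c ∈ T.children u, T.harmonicSum (A c).edges (T.subtree c) ≤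
      phiConst * #(T.subtree c) - deltaConst - T.increase (A m) 1) :
    T.harmonicSum (T.join u A m).edges (T.subtree u) ≤
      phiConst * #(T.subtree u) - T.increase (T.join u A m) 1 - deltaConst -
        betaFun #(T.children u) := by
  have hmg := hA m hm
  refine join_bound (fun c hc => (hA c hc).isOutput) hm hu h ?_
  have hpos := card_pos.2 ⟨m, hm⟩
  have key := harmonic_marked_path_le #(T.children m) #(T.children u)
    (card_pos.2 (children_nonempty hmf)) hpos
  -- The leaf has load at least $a+1$, so its increment is at most the one starting from $a+1$.
  have hleaf := harmonic_add_sub_antitone (hmg.lt_load_leaf hmf) (#(T.children u) - 1)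
  rw [show #(T.children m) + 1 + (#(T.children u) - 1) = #(T.children m) + #(T.children u) by
    omega] at hleaf
  have htop : m ∈ (A m).path.erase (A m).leaf :=
    mem_erase.2 ⟨fun h => hmf (h ▸ hmg.isOutput.leaf_final), hmg.isOutput.top_mem_path⟩
  have hpath : ∑ v ∈ (A m).path.erase (A m).leaf,
        (harmonic (T.load (A m).edges v + #(T.children u)) -
          harmonic (T.load (A m).edges v)) - #(T.children u) * T.increase (A m) 1 ≤
      harmonic (#(T.children m) + #(T.children u)) - harmonic #(T.children m) -
        #(T.children u) * (harmonic (#(T.children m) + 1) - harmonic #(T.children m)) := by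
    -- The top vertex $m$ is split off, its load being exactly $a$; every other term is nonpositive
    -- by concavity.
    rw [increase_one, mul_sum, ← sum_sub_distrib, ← add_sum_erase _ _ htop, hmg.load_top hmf,
      add_le_iff_nonpos_right]
    exact sum_nonpos fun v _ => sub_nonpos.2 (harmonic_add_sub_le _ _)
  linarith

theorem isGood_join
    (hb : T.harmonicSum (T.join u A m).edges (T.subtree u) ≤
      phiConst * #(T.subtree u) - T.increase (T.join u A m) 1 - deltaConst -
        betaFun #(T.children u)) : IsGood T u (T.join u A m) where
  ne_root := fun h => hu (h ▸ T.root_final)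
  isOutput := isOutput_join (fun c hc => (hA c hc).isOutput) hm
  eq_of_final h := absurd h hu
  load_top _ := load_join_top (fun c hc => (hA c hc).isOutput) hm hu
  lt_load_leaf _ := by
    have hmo := (hA m hm).isOutput
    -- The leaf already has load $2$, from being final and from $e^m$; adding $k-1$ gives at least
    -- $k+1$.
    have h2 := hmo.two_le_load_leaf (ne_root_of_mem_children hm)
    change _ < T.load _ (A m).leaf
    rw [load_join_of_mem (fun c hc => (hA c hc).isOutput) hm hm hmo.leaf_mem,
      if_pos hmo.leaf_mem_path]
    omega
  bound := hb

end join

/-! ### Induction over runs of the algorithm, and existence of a run. -/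

theorem phiConst_sub_deltaConst_sub : phiConst - deltaConst - harmonic 2 = 9 / 70 := by
  norm_num [phiConst, deltaConst, harmonic_succ]

theorem Builds.isGood {u : V} {A : MarkingOutput V} (h : T.Builds u A) : IsGood T u A := by
  induction h with
  | final u hne hu => exact isGood_final hne hu
  | node u A m hu _ hm hA =>
    obtain ⟨hmc, hm⟩ := hm
    rw [phiConst_sub_deltaConst_sub] at hm
    refine isGood_join hA hmc hu ?_
    rcases hm with ⟨hnf, hmin⟩ | ⟨hmf, hle⟩ | ⟨-, ⟨d, hd, hdf, hlt⟩, hmf, hmin⟩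
    · exact join_bound_of_notMem_final hA hmc hu (hnf m hmc) fun c hc =>
        (hA c hc).bound_of_le (hmin c hc)
    · exact join_bound_final hA hmc hu hmf hle
    · refine join_bound_of_notMem_final hA hmc hu hmf fun c hc => ?_
      by_cases hcf : c ∈ T.final
      -- A final child gains $9/70$, and $C_1^m\le C_1^d<9/70$, so it too gains at least $C_1^m$.
      · linarith [(hA c hc).bound_final hcf, hmin d hd hdf]
      · exact (hA c hc).bound_of_le (hmin c hc hcf)

theorem exists_mayMark {u : V} (hu : u ∉ T.final) (A : V → MarkingOutput V) :
    ∃ m, T.MayMark u A m := by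
  by_cases hnf : ∀ c ∈ T.children u, c ∉ T.final
  · obtain ⟨m, hm, hmin⟩ := exists_min_image (T.children u) (fun c => T.increase (A c) 1)
      (children_nonempty hu)
    exact ⟨m, hm, .inl ⟨hnf, hmin⟩⟩
  · push Not at hnf
    obtain ⟨f, hf, hff⟩ := hnf
    by_cases hle : ∀ c ∈ T.children u, c ∉ T.final →
        phiConst - deltaConst - harmonic 2 ≤ T.increase (A c) 1
    · exact ⟨f, hf, .inr (.inl ⟨hff, hle⟩)⟩
    · push Not at hle
      obtain ⟨d, hd, hdf, hlt⟩ := hle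
      obtain ⟨m, hm, hmin⟩ := exists_min_image {c ∈ T.children u | c ∉ T.final}
        (fun c => T.increase (A c) 1) ⟨d, mem_filter.2 ⟨hd, hdf⟩⟩
      rw [mem_filter] at hm
      exact ⟨m, hm.1, .inr (.inr ⟨⟨f, hf, hff⟩, ⟨d, hd, hdf, hlt⟩, hm.2,
        fun c hc hcf => hmin c (mem_filter.2 ⟨hc, hcf⟩)⟩)⟩

theorem exists_builds (u : V) (hu : u ≠ T.root) : ∃ A, T.Builds u A := by
  by_cases huf : u ∈ T.final
  · exact ⟨_, .final u hu huf⟩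
  · have ih : ∀ c : V, ∃ A, c ∈ T.children u → T.Builds c A := fun c => by
      by_cases hc : c ∈ T.children u
      · have : #(T.subtree c) < #(T.subtree u) :=
          card_lt_card ((ssubset_iff_of_subset (subtree_subset (mem_children.1 hc).2)).2
            ⟨u, self_mem_subtree u, notMem_subtree_of_mem_children hc⟩)
        obtain ⟨A, hA⟩ := exists_builds c (ne_root_of_mem_children hc)
        exact ⟨A, fun _ => hA⟩
      -- An arbitrary value: outputs away from the children of $u$ play no role.
      · exact ⟨⟨∅, u, ∅⟩, fun h => absurd h hc⟩
    choose A hA using ih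
    obtain ⟨m, hm⟩ := exists_mayMark huf A
    exact ⟨_, .node u A m huf hA hm⟩
termination_by #(T.subtree u)

end FinalTree

theorem mainTheorem1 {V : Type*} [Fintype V] [DecidableEq V] (T : FinalTree V) (u : V)
    (hu : u ≠ T.root) :
    (∃ A : MarkingOutput V, T.Builds u A) ∧
      ∀ A : MarkingOutput V, T.Builds u A →
        T.harmonicSum A.edges (T.subtree u) ≤
          phiConst * (#(T.subtree u) : ℚ) - T.increase A 1 - deltaConst
            - betaFun #(T.children u) :=
  ⟨FinalTree.exists_builds u hu, fun _ hA => hA.isGood.bound⟩
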